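/- Let $\cdots\le t_{-1}\le t_0\le 0<t_1\le t_2\le\cdots$ be the points of a (locally finite) point process on the real line, let $N(t)$ be the number of points in $(0,t]$ and let $\tau_k=t_k-t_{k-1}$ be the durations. Let $e_1,e_2,\dots$ be i.i.d. random variables with mean zero and finite variance $\sigma_e^2$ ($\sigma_e\ge 0$), and assume that the sequence $\{e_k\}$ is independent of the counting process $N(\cdot)$. For $\mu\in\mathbb{R}$ put $$y(t)=\mu N(t)+\sum_{k=1}^{N(t)}e_k ,\qquad t\ge 0 .$$ Let $\lambda>0$ and $1/2\le\gamma<1$, and suppose that, as $n\to\infty$ through the integers, $n^{-\gamma}\sum_{k=1}^{n}(\tau_k-1/\lambda)$ converges in distribution to a random variable $A$ that is not almost surely zero. If $\gamma>1/2$, then $n^{-\gamma}(y(n)-\lambda\mu n)$ converges in distribution to $-\mu\lambda^{1+\gamma}A$. If $\gamma=1/2$, then $n^{-1/2}(y(n)-\lambda\mu n)$ converges in distribution to $-\mu\lambda^{3/2}A+\sqrt{\lambda}\,\sigma_e Z$, where $Z$ is a standard Gaussian random variable independent of $A$. -/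

import Mathlib

open MeasureTheory ProbabilityTheory Filter Topology
open scoped NNReal

/-- `T k ω`, `k ∈ ℤ`, are the points `⋯ ≤ t₋₁ ≤ t₀ ≤ 0 < t₁ ≤ t₂ ≤ ⋯` of a point process on the
real line (locally finite, multiple points allowed), counted with multiplicity. -/
structure IsPointProcess {Ω : Type*} [MeasurableSpace Ω] (T : ℤ → Ω → ℝ) : Prop where
  measurable : ∀ k, Measurable (T k)
  monotone : ∀ ω, Monotone (fun k => T k ω)
  zero_nonpos : ∀ ω, T 0 ω ≤ 0
  one_pos : ∀ ω, 0 < T 1 ω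
  tendsto_atTop : ∀ ω, Tendsto (fun k => T k ω) atTop atTop
  tendsto_atBot : ∀ ω, Tendsto (fun k => T k ω) atBot atBot

/-- The duration `τ_k = t_k - t_{k-1}`. -/
def duration {Ω : Type*} (T : ℤ → Ω → ℝ) (k : ℤ) (ω : Ω) : ℝ := T k ω - T (k - 1) ω

/-- The counting process: `N(t)` is the number of points in `(0, t]`, with multiplicity. -/
noncomputable def count {Ω : Type*} (T : ℤ → Ω → ℝ) (t : ℝ≥0) (ω : Ω) : ℕ :=
  {k : ℤ | T k ω ∈ Set.Ioc 0 (t : ℝ)}.ncard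

/-- The pure-jump log price `y(t) = μ N(t) + ∑_{k=1}^{N(t)} e_k`. The shocks are indexed from `0`,
so that `e k` is the shock `e_{k+1}` of the `(k+1)`-st transaction after time `0`. -/
noncomputable def logPrice {Ω : Type*} (μ : ℝ) (T : ℤ → Ω → ℝ) (e : ℕ → Ω → ℝ)
    (t : ℝ≥0) (ω : Ω) : ℝ :=
  μ * (count T t ω : ℝ) + ∑ k ∈ Finset.range (count T t ω), e k ω

/-! The counting process inverts the event times: `N(t) < j` exactly when `t < t_j`. Hence the
distribution function of `n^(-γ) (N(n) - λn)` at `x` is the probability that `t_k > n`, with `k =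
⌈λn + x n^γ⌉`. Since `k/n → λ`, the threshold for the normalized `t_k` tends to `-x / λ^(1+γ)`, and
the limit of the counts is `-λ^(1+γ) A` (`IsPointProcess.tendstoInDistribution_count`).

For the shocks, `N(n)/n → λ` in probability. As `N(n)` is independent of the shocks, Chebyshev
applied for each fixed value of the index shows that replacing `N(n)` by `⌊λn⌋` costs `o(n^γ)` in
probability (`tendstoInMeasure_random_sum_sub`). The sum to `⌊λn⌋` is negligible if `γ > 1/2`. If `γ
= 1/2` it obeys the central limit theorem and, having a deterministic index, is independent of
`N(n)`, so the two limits hold jointly with an independent pair as limit. -/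

/-! ### Tools for convergence in distribution. -/

section ConvergenceInDistribution

variable {Ω Ω' Ω'' E : Type*} [MeasurableSpace Ω] {P : Measure Ω} [IsProbabilityMeasure P]
  [MeasurableSpace Ω'] {P' : Measure Ω'} [IsProbabilityMeasure P']
  [MeasurableSpace Ω''] {P'' : Measure Ω''} [IsProbabilityMeasure P'']

/-- The law of a half-open interval in terms of left-continuous distribution functions. -/
theorem map_measureReal_Ico {X : Ω → ℝ} (hX : AEMeasurable X P) {a b : ℝ} (hab : a < b) :
    (P.map X).real (Set.Ico a b) = P.real {ω | X ω < b} - P.real {ω | X ω < a} := by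
  have h : ∀ c, P.real {ω | X ω < c} = (P.map X).real (Set.Iio c) := fun c => by
    rw [map_measureReal_apply_of_aemeasurable hX measurableSet_Iio]; rfl
  have : IsProbabilityMeasure (P.map X) := Measure.isProbabilityMeasure_map hX
  rw [h, h, ← measureReal_sdiff (Set.Iio_subset_Iio hab.le) measurableSet_Iio]
  congr 1
  ext
  simp

/-- Convergence of the distribution functions `P(X n < x)` at the continuity points of the limit
implies convergence in distribution. -/
theorem tendstoInDistribution_of_tendsto_measureReal_lt {X : ℕ → Ω → ℝ} {Z : Ω' → ℝ}
    (hX : ∀ n, AEMeasurable (X n) P) (hZ : AEMeasurable Z P')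
    (h : ∀ x, P' {ω | Z ω = x} = 0 →
      Tendsto (fun n => P.real {ω | X n ω < x}) atTop (𝓝 (P'.real {ω | Z ω < x}))) :
    TendstoInDistribution X atTop Z (fun _ => P) P' where
  forall_aemeasurable := hX
  aemeasurable_limit := hZ
  tendsto := by
    -- The non-atoms of the limit are co-countable, hence dense, so half-open intervals with
    -- endpoints in `D` form a convergence-determining π-system.
    set D : Set ℝ := {x | P' {ω | Z ω = x} = 0} with hD
    have hDdense : Dense D := by
      have hc : {t : ℝ | 0 < P' {ω | Z ω = t}}.Countable :=
        Measure.countable_meas_level_set_pos₀ hZ.nullMeasurable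
      convert hc.dense_compl ℝ using 1
      ext x
      simp [hD]
    refine (isPiSystem_Ico_mem D D).tendsto_probabilityMeasure_of_tendsto_of_mem ?_ ?_ ?_
    · rintro _ ⟨a, -, b, -, -, rfl⟩
      exact measurableSet_Ico
    · intro u hu x hx
      obtain ⟨ε, hε, hεu⟩ := Metric.isOpen_iff.1 hu x hx
      obtain ⟨a, haD, ha⟩ := hDdense.exists_between (show x - ε < x by linarith)
      obtain ⟨b, hbD, hb⟩ := hDdense.exists_between (show x < x + ε by linarith)
      refine ⟨_, ⟨a, haD, b, hbD, ha.2.trans hb.1, rfl⟩, Ico_mem_nhds ha.2 hb.1, fun y hy => hεu ?_⟩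
      rw [Real.ball_eq_Ioo]
      exact ⟨ha.1.trans_le hy.1, hy.2.trans hb.2⟩
    · rintro _ ⟨a, ha, b, hb, hab, rfl⟩
      rw [← NNReal.tendsto_coe]
      have := (h b hb).sub (h a ha)
      rw [← map_measureReal_Ico hZ hab] at this
      refine this.congr fun n => ?_
      exact (map_measureReal_Ico (hX n) hab).symm

theorem MeasureTheory.TendstoInDistribution.tendsto_measureReal_preimage
    [TopologicalSpace E] [MeasurableSpace E] [BorelSpace E] [HasOuterApproxClosed E]
    {X : ℕ → Ω → E} {Z : Ω' → E} (h : TendstoInDistribution X atTop Z (fun _ => P) P')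
    {s : Set E} (hs : MeasurableSet s) (hfr : P' (Z ⁻¹' frontier s) = 0) :
    Tendsto (fun n => P.real (X n ⁻¹' s)) atTop (𝓝 (P'.real (Z ⁻¹' s))) := by
  have hZ := h.aemeasurable_limit
  have := ProbabilityMeasure.tendsto_measure_of_null_frontier_of_tendsto' h.tendsto (E := s)
    (by simpa [Measure.map_apply_of_aemeasurable hZ isClosed_frontier.measurableSet] using hfr)
  simp only [ProbabilityMeasure.coe_mk, Measure.map_apply_of_aemeasurable hZ hs,
    Measure.map_apply_of_aemeasurable (h.forall_aemeasurable _) hs] at this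
  exact (ENNReal.tendsto_toReal (measure_ne_top _ _)).comp this

theorem MeasureTheory.TendstoInDistribution.comp_tendsto
    [TopologicalSpace E] [MeasurableSpace E] [OpensMeasurableSpace E]
    {X : ℕ → Ω → E} {Z : Ω' → E} (h : TendstoInDistribution X atTop Z (fun _ => P) P')
    {k : ℕ → ℕ} (hk : Tendsto k atTop atTop) :
    TendstoInDistribution (fun n => X (k n)) atTop Z (fun _ => P) P' where
  forall_aemeasurable n := h.forall_aemeasurable (k n)
  aemeasurable_limit := h.aemeasurable_limit
  tendsto := h.tendsto.comp hk

/-- Lets the limit be realized on a space that also carries an independent Gaussian. -/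
theorem MeasureTheory.TendstoInDistribution.congr_limit
    [TopologicalSpace E] [MeasurableSpace E] [OpensMeasurableSpace E]
    {X : ℕ → Ω → E} {Z : Ω' → E} {Z' : Ω'' → E}
    (h : TendstoInDistribution X atTop Z (fun _ => P) P') (hZ : IdentDistrib Z' Z P'' P') :
    TendstoInDistribution X atTop Z' (fun _ => P) P'' where
  forall_aemeasurable := h.forall_aemeasurable
  aemeasurable_limit := hZ.aemeasurable_fst
  tendsto := by
    convert! h.tendsto using 2
    exact congrArg 𝓝 (Subtype.ext hZ.map_eq)

/-- Deterministic sequences converge in measure. -/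
theorem tendstoInMeasure_const_of_tendsto {c : ℕ → ℝ} {a : ℝ} (hc : Tendsto c atTop (𝓝 a)) :
    TendstoInMeasure P (fun n _ => c n) atTop (fun _ => a) :=
  tendstoInMeasure_of_tendsto_ae (fun _ => aestronglyMeasurable_const) (.of_forall fun _ => hc)

theorem MeasureTheory.TendstoInDistribution.const_mul_of_tendsto
    {X : ℕ → Ω → ℝ} {Z : Ω' → ℝ} (h : TendstoInDistribution X atTop Z (fun _ => P) P')
    {c : ℕ → ℝ} {a : ℝ} (hc : Tendsto c atTop (𝓝 a)) :
    TendstoInDistribution (fun n ω => c n * X n ω) atTop (fun ω => a * Z ω) (fun _ => P) P' :=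
  h.continuous_comp_prodMk_of_tendstoInMeasure_const (g := fun p : ℝ × ℝ => p.2 * p.1)
    (by fun_prop) (tendstoInMeasure_const_of_tendsto hc) (fun _ => aemeasurable_const)

/-- Convergence of tail probabilities along moving thresholds. -/
theorem MeasureTheory.TendstoInDistribution.tendsto_measureReal_gt
    {X : ℕ → Ω → ℝ} {Z : Ω' → ℝ} (h : TendstoInDistribution X atTop Z (fun _ => P) P')
    {c : ℕ → ℝ} {a : ℝ} (hc : Tendsto c atTop (𝓝 a)) (ha : P' {ω | Z ω = a} = 0) :
    Tendsto (fun n => P.real {ω | c n < X n ω}) atTop (𝓝 (P'.real {ω | a < Z ω})) := by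
  -- Slutsky turns the moving threshold into the fixed threshold `0`.
  have h1 : TendstoInDistribution (fun n ω => X n ω - c n) atTop (fun ω => Z ω - a)
      (fun _ => P) P' :=
    h.continuous_comp_prodMk_of_tendstoInMeasure_const (g := fun p : ℝ × ℝ => p.1 - p.2)
      (by fun_prop) (tendstoInMeasure_const_of_tendsto hc) (fun _ => aemeasurable_const)
  have h2 := h1.tendsto_measureReal_preimage (s := Set.Ioi 0) measurableSet_Ioi
    (by simpa [frontier_Ioi, Set.preimage, sub_eq_zero] using ha)
  simpa [Set.preimage, sub_pos] using h2

/-- Componentwise convergence in distribution of independent pairs is joint convergence. -/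
theorem MeasureTheory.TendstoInDistribution.prodMk_of_indepFun
    {X Y : ℕ → Ω → ℝ} {U V : Ω' → ℝ} (hX : TendstoInDistribution X atTop U (fun _ => P) P')
    (hY : TendstoInDistribution Y atTop V (fun _ => P) P')
    (hXY : ∀ n, IndepFun (X n) (Y n) P) (hUV : IndepFun U V P') :
    TendstoInDistribution (fun n ω => (X n ω, Y n ω)) atTop (fun ω => (U ω, V ω))
      (fun _ => P) P' where
  forall_aemeasurable n := (hX.forall_aemeasurable n).prodMk (hY.forall_aemeasurable n)
  aemeasurable_limit := hX.aemeasurable_limit.prodMk hY.aemeasurable_limit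
  tendsto := by
    have := (ProbabilityMeasure.continuous_prod (α := ℝ) (β := ℝ)).tendsto _ |>.comp
      (hX.tendsto.prodMk_nhds hY.tendsto)
    convert! this using 2
    · exact congrArg Tendsto (funext fun n => Subtype.ext <| (hXY n).map_prod_eq_prod_map_map
        (hX.forall_aemeasurable n) (hY.forall_aemeasurable n))
    · exact congrArg 𝓝 <| Subtype.ext <|
        hUV.map_prod_eq_prod_map_map hX.aemeasurable_limit hY.aemeasurable_limit

end ConvergenceInDistribution

/-! ### Event times and counts. -/

section Counting

variable {Ω : Type*} [MeasurableSpace Ω] {T : ℤ → Ω → ℝ}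

theorem IsPointProcess.pos_iff (hT : IsPointProcess T) {k : ℤ} {ω : Ω} : 0 < T k ω ↔ 1 ≤ k := by
  refine ⟨fun h => ?_, fun h => (hT.one_pos ω).trans_le (hT.monotone ω h)⟩
  by_contra! hk
  exact absurd (hT.monotone ω (show k ≤ 0 by omega)) (by simpa using (hT.zero_nonpos ω).trans_lt h)

/-- By monotonicity, the points in `(0, t]` are an initial segment of `t₁ ≤ t₂ ≤ ⋯`; it reaches
`t_j` precisely when `t_j ≤ t`. -/
theorem IsPointProcess.count_lt_iff (hT : IsPointProcess T) {j : ℕ} (hj : 1 ≤ j) {t : ℝ≥0} {ω : Ω} :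
    count T t ω < j ↔ (t : ℝ) < T j ω := by
  -- Needed because `ncard` of an infinite set is `0`.
  have hfin : {k : ℤ | T k ω ∈ Set.Ioc 0 (t : ℝ)}.Finite := by
    obtain ⟨m, hm⟩ := ((hT.tendsto_atTop ω).eventually_gt_atTop (t : ℝ)).exists
    refine (Set.finite_Icc (1 : ℤ) m).subset fun k hk => ⟨hT.pos_iff.1 hk.1, ?_⟩
    by_contra! hkm
    exact absurd (hT.monotone ω hkm.le) (not_le.2 (hk.2.trans_lt hm))
  constructor
  · intro h
    by_contra! hjt
    have hsub : (Finset.Icc (1 : ℤ) j : Set ℤ) ⊆ {k : ℤ | T k ω ∈ Set.Ioc 0 (t : ℝ)} := by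
      intro k hk
      rw [Finset.coe_Icc] at hk
      exact ⟨hT.pos_iff.2 hk.1, (hT.monotone ω hk.2).trans hjt⟩
    have := Set.ncard_le_ncard hsub hfin
    rw [Set.ncard_coe_finset, Int.card_Icc] at this
    simp only [count] at h
    omega
  · intro h
    have hsub : {k : ℤ | T k ω ∈ Set.Ioc 0 (t : ℝ)} ⊆ (Finset.Ico (1 : ℤ) j : Set ℤ) := by
      intro k hk
      rw [Finset.coe_Ico]
      refine ⟨hT.pos_iff.1 hk.1, ?_⟩
      by_contra! hkj
      exact absurd (hT.monotone ω hkj) (not_le.2 (hk.2.trans_lt h))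
    have := Set.ncard_le_ncard hsub (Finset.finite_toSet _)
    rw [Set.ncard_coe_finset, Int.card_Ico] at this
    simp only [count]
    omega

theorem IsPointProcess.measurable_count (hT : IsPointProcess T) (t : ℝ≥0) :
    Measurable (count T t) := by
  refine measurable_of_Iio fun j => ?_
  rcases Nat.eq_zero_or_pos j with rfl | hj
  · simp
  · have : count T t ⁻¹' Set.Iio j = {ω | (t : ℝ) < T j ω} := by
      ext ω
      exact hT.count_lt_iff hj
    rw [this]
    exact measurableSet_lt measurable_const (hT.measurable j)

end Counting

theorem sum_Icc_duration {Ω : Type*} (T : ℤ → Ω → ℝ) (c : ℝ) (n : ℕ) (ω : Ω) :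
    ∑ k ∈ Finset.Icc (1 : ℤ) n, (duration T k ω - c) = T n ω - T 0 ω - c * n := by
  induction n with
  | zero => simp
  | succ n ih =>
    have : Finset.Icc (1 : ℤ) ((n + 1 : ℕ) : ℤ) =
        insert ((n + 1 : ℕ) : ℤ) (Finset.Icc (1 : ℤ) n) := by
      ext k
      simp only [Finset.mem_Icc, Finset.mem_insert]
      omega
    rw [this, Finset.sum_insert (by simp), ih]
    simp only [duration]
    push_cast
    rw [add_sub_cancel_right]
    ring

/-! ### Deterministic asymptotics of the inverted index. -/

section Asymptotics

theorem tendsto_natCast_rpow_neg {s : ℝ} (hs : 0 < s) :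
    Tendsto (fun n : ℕ => (n : ℝ) ^ (-s)) atTop (𝓝 0) :=
  (tendsto_rpow_neg_atTop hs).comp tendsto_natCast_atTop_atTop

/-- Rounding up costs at most `1`, hence at most `n^(-γ)` after scaling. -/
theorem tendsto_rpow_neg_mul_ceil_sub {lam γ : ℝ} (hlam : 0 < lam) (hγ : 0 < γ) (hγ1 : γ < 1)
    (x : ℝ) :
    Tendsto (fun n : ℕ => (n : ℝ) ^ (-γ) * ((⌈lam * n + x * (n : ℝ) ^ γ⌉₊ : ℝ) - lam * n))
      atTop (𝓝 x) := by
  have h0 := tendsto_natCast_rpow_neg hγ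
  have h1 := tendsto_natCast_rpow_neg (show 0 < 1 - γ by linarith)
  -- The argument of the ceiling is `n` times this factor, so for large `n` the truncation of `⌈·⌉₊`
  -- at zero plays no role.
  have hpos : ∀ᶠ n : ℕ in atTop, 0 < lam + x * (n : ℝ) ^ (-(1 - γ)) := by
    have : Tendsto (fun n : ℕ => lam + x * (n : ℝ) ^ (-(1 - γ))) atTop (𝓝 (lam + x * 0)) :=
      (h1.const_mul x).const_add lam
    exact this.eventually_const_lt (by simpa using hlam)
  have hup : Tendsto (fun n : ℕ => x + (n : ℝ) ^ (-γ)) atTop (𝓝 x) := by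
    simpa using h0.const_add x
  refine tendsto_of_tendsto_of_tendsto_of_le_of_le' tendsto_const_nhds hup ?_ ?_
  all_goals
    filter_upwards [hpos, eventually_gt_atTop 0] with n hn hn0
    have hn0' : (0 : ℝ) < n := by exact_mod_cast hn0
    have hg : (n : ℝ) ^ (-γ) * (n : ℝ) ^ γ = 1 := by
      rw [← Real.rpow_add hn0']; simp
    have hgp : 0 < (n : ℝ) ^ (-γ) := Real.rpow_pos_of_pos hn0' _
  · have := Nat.le_ceil (lam * n + x * (n : ℝ) ^ γ)
    calc x = (n : ℝ) ^ (-γ) * (x * (n : ℝ) ^ γ) := by rw [mul_left_comm, hg, mul_one]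
      _ ≤ _ := by gcongr; linarith
  · have hnn : 0 ≤ lam * n + x * (n : ℝ) ^ γ := by
      have : (n : ℝ) * (n : ℝ) ^ (-(1 - γ)) = (n : ℝ) ^ γ := by
        nth_rw 1 [← Real.rpow_one (n : ℝ)]
        rw [← Real.rpow_add hn0']; ring_nf
      rw [← this]
      have := mul_pos hn0' hn
      nlinarith
    have := (Nat.ceil_lt_add_one hnn).le
    calc _ ≤ (n : ℝ) ^ (-γ) * (x * (n : ℝ) ^ γ + 1) := by gcongr; linarith
      _ = _ := by rw [mul_add, mul_left_comm, hg]; ring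

theorem tendsto_div_of_tendsto_rpow_neg_mul_sub {lam γ x : ℝ} (hγ1 : γ < 1) {k : ℕ → ℝ}
    (hk : Tendsto (fun n : ℕ => (n : ℝ) ^ (-γ) * (k n - lam * n)) atTop (𝓝 x)) :
    Tendsto (fun n : ℕ => k n / n) atTop (𝓝 lam) := by
  have h1 := tendsto_natCast_rpow_neg (show 0 < 1 - γ by linarith)
  have h2 : Tendsto (fun n : ℕ => lam + (n : ℝ) ^ (-(1 - γ)) *
      ((n : ℝ) ^ (-γ) * (k n - lam * n))) atTop (𝓝 lam) := by
    simpa using (h1.mul hk).const_add lam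
  refine h2.congr' ?_
  filter_upwards [eventually_gt_atTop 0] with n hn0
  have hn0' : (0 : ℝ) < n := by exact_mod_cast hn0
  rw [← mul_assoc, ← Real.rpow_add hn0', show -(1 - γ) + -γ = -1 by ring, Real.rpow_neg_one]
  field_simp
  ring

theorem tendsto_atTop_of_tendsto_div {lam : ℝ} (hlam : 0 < lam) {k : ℕ → ℕ}
    (hk : Tendsto (fun n : ℕ => (k n : ℝ) / n) atTop (𝓝 lam)) : Tendsto k atTop atTop := by
  rw [← tendsto_natCast_atTop_iff (R := ℝ)]
  refine (hk.pos_mul_atTop hlam (tendsto_natCast_atTop_atTop (R := ℝ))).congr' ?_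
  filter_upwards [eventually_gt_atTop 0] with n hn0
  have hn0' : (0 : ℝ) < n := by exact_mod_cast hn0
  field_simp

end Asymptotics

/-! ### From event times to counts. -/

section Inversion

variable {Ω Ω' : Type*} [MeasurableSpace Ω] {P : Measure Ω} [IsProbabilityMeasure P]
  [MeasurableSpace Ω'] {P' : Measure Ω'} [IsProbabilityMeasure P'] {T : ℤ → Ω → ℝ}

/-- The normalized sums of durations and the normalized event times have the same limit. -/
theorem IsPointProcess.tendstoInDistribution_time (hT : IsPointProcess T) {lam γ : ℝ} (hγ : 0 < γ)
    {A : Ω' → ℝ}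
    (hconv : TendstoInDistribution
      (fun (n : ℕ) ω =>
        (n : ℝ) ^ (-γ) * ∑ k ∈ Finset.Icc (1 : ℤ) n, (duration T k ω - 1 / lam))
      atTop A (fun _ => P) P') :
    TendstoInDistribution (fun (n : ℕ) ω => (n : ℝ) ^ (-γ) * (T n ω - n / lam))
      atTop A (fun _ => P) P' := by
  have hmeas : ∀ n : ℕ, AEMeasurable (fun ω => (n : ℝ) ^ (-γ) * T 0 ω) P :=
    fun n => ((hT.measurable 0).const_mul _).aemeasurable
  -- The durations telescope to `T n - T 0`; the fixed variable `T 0` vanishes under the scaling.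
  have h0 : TendstoInMeasure P (fun (n : ℕ) ω => (n : ℝ) ^ (-γ) * T 0 ω) atTop (fun _ => 0) :=
    tendstoInMeasure_of_tendsto_ae (fun n => (hmeas n).aestronglyMeasurable)
      (.of_forall fun ω => by simpa using (tendsto_natCast_rpow_neg hγ).mul_const (T 0 ω))
  have h := hconv.add_of_tendstoInMeasure_const h0 hmeas
  refine h.congr (fun n => .of_forall fun ω => ?_) (.of_forall fun ω => by simp)
  simp only [Pi.add_apply, sum_Icc_duration]
  ring

/-- Inversion: a limit theorem for the event times gives one for the counting process. -/
theorem IsPointProcess.tendstoInDistribution_count (hT : IsPointProcess T) {lam γ : ℝ}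
    (hlam : 0 < lam) (hγ : 0 < γ) (hγ1 : γ < 1) {A : Ω' → ℝ}
    (hconv : TendstoInDistribution (fun (n : ℕ) ω => (n : ℝ) ^ (-γ) * (T n ω - n / lam))
      atTop A (fun _ => P) P') :
    TendstoInDistribution (fun (n : ℕ) ω => (n : ℝ) ^ (-γ) * ((count T n ω : ℝ) - lam * n))
      atTop (fun ω' => -lam ^ (1 + γ) * A ω') (fun _ => P) P' := by
  have hA := hconv.aemeasurable_limit
  have hmeas : ∀ n : ℕ,
      AEMeasurable (fun ω => (n : ℝ) ^ (-γ) * ((count T n ω : ℝ) - lam * n)) P := fun n =>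
    ((((measurable_of_countable fun m : ℕ => (m : ℝ)).comp
      (hT.measurable_count n)).sub_const _).const_mul _).aemeasurable
  refine tendstoInDistribution_of_tendsto_measureReal_lt hmeas (hA.const_mul _) fun x hx => ?_
  set k : ℕ → ℕ := fun n => ⌈lam * n + x * (n : ℝ) ^ γ⌉₊ with hk
  have hk1 := tendsto_rpow_neg_mul_ceil_sub hlam hγ hγ1 x
  have hk2 : Tendsto (fun n : ℕ => (k n : ℝ) / n) atTop (𝓝 lam) :=
    tendsto_div_of_tendsto_rpow_neg_mul_sub hγ1 hk1
  have hk3 : Tendsto k atTop atTop := tendsto_atTop_of_tendsto_div hlam hk2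
  set a : ℝ := lam ^ (-γ) * (-(1 / lam) * x) with ha
  -- The threshold equals `(k/n)^(-γ) * (-1/λ) * n^(-γ) (k - λn)`.
  have hc : Tendsto (fun n : ℕ => (k n : ℝ) ^ (-γ) * (n - k n / lam)) atTop (𝓝 a) := by
    have := (hk2.rpow_const (p := -γ) (.inl hlam.ne')).mul (hk1.const_mul (-(1 / lam)))
    refine this.congr' ?_
    filter_upwards [eventually_gt_atTop 0] with n hn0
    have hn0' : (0 : ℝ) < n := by exact_mod_cast hn0
    rw [Real.div_rpow (Nat.cast_nonneg _) hn0'.le]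
    have := (Real.rpow_pos_of_pos hn0' (-γ)).ne'
    field_simp
    ring
  have hl : lam ^ (1 + γ) * a = -x := by
    rw [ha, ← mul_assoc, ← Real.rpow_add hlam, show 1 + γ + -γ = 1 by ring, Real.rpow_one]
    field_simp
  have hlp : 0 < lam ^ (1 + γ) := Real.rpow_pos_of_pos hlam _
  -- `x` is an atom of `-λ^(1+γ) A` exactly when `a` is an atom of `A`.
  have ha0 : P' {ω | A ω = a} = 0 := by
    convert hx using 3
    ext ω
    rw [neg_mul, neg_eq_iff_eq_neg, ← hl, mul_right_inj' hlp.ne']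
  have hlim := (hconv.comp_tendsto hk3).tendsto_measureReal_gt hc ha0
  have hset : {ω | -lam ^ (1 + γ) * A ω < x} = {ω | a < A ω} := by
    ext ω
    simp only [Set.mem_ofPred_eq]
    rw [neg_mul, neg_lt, ← hl, mul_lt_mul_iff_right₀ hlp]
  rw [hset]
  refine hlim.congr' ?_
  filter_upwards [eventually_gt_atTop 0, hk3.eventually_ge_atTop 1] with n hn0 hkn
  have hn0' : (0 : ℝ) < n := by exact_mod_cast hn0
  have hk0' : (0 : ℝ) < k n := by exact_mod_cast hkn
  congr 1
  ext ω
  simp only [Set.mem_ofPred_eq]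
  have hg : (n : ℝ) ^ γ * (n : ℝ) ^ (-γ) = 1 := by rw [← Real.rpow_add hn0']; simp
  have hN : (n : ℝ) ^ (-γ) * ((count T n ω : ℝ) - lam * n) < x ↔ count T n ω < k n := by
    rw [← mul_lt_mul_iff_right₀ (Real.rpow_pos_of_pos hn0' γ), ← mul_assoc, hg, one_mul,
      sub_lt_iff_lt_add, add_comm, mul_comm _ x, ← Nat.lt_ceil]
  rw [hN, hT.count_lt_iff hkn, NNReal.coe_natCast,
    mul_lt_mul_iff_right₀ (Real.rpow_pos_of_pos hk0' _), sub_lt_sub_iff_right]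

end Inversion

/-! ### Sums of shocks up to random and deterministic indices. -/

section RandomSums

variable {Ω Ω' : Type*} [MeasurableSpace Ω] {P : Measure Ω} [IsProbabilityMeasure P]
  [MeasurableSpace Ω'] {P' : Measure Ω'} [IsProbabilityMeasure P']

/-- If `ξ` is independent of the integer random variable `N`, a bound on `P(ξ ∈ B j)` uniform in
`j ∈ J` also bounds the probability that `N ∈ J` and `ξ ∈ B N`. -/
theorem measure_mem_and_mem_random_index_le {β : Type*} [MeasurableSpace β] {N : Ω → ℕ}
    (hN : Measurable N) {ξ : Ω → β} (h : IndepFun ξ N P) {J : Set ℕ} {B : ℕ → Set β}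
    (hB : ∀ j, MeasurableSet (B j)) {c : ENNReal} (hc : ∀ j ∈ J, P (ξ ⁻¹' B j) ≤ c) :
    P {ω | N ω ∈ J ∧ ξ ω ∈ B (N ω)} ≤ c := by
  calc P {ω | N ω ∈ J ∧ ξ ω ∈ B (N ω)}
      ≤ P (⋃ j : J, ξ ⁻¹' B j ∩ N ⁻¹' {(j : ℕ)}) := by
        refine measure_mono fun ω hω => Set.mem_iUnion.2 ⟨⟨N ω, hω.1⟩, hω.2, rfl⟩
    _ ≤ ∑' j : J, P (ξ ⁻¹' B j ∩ N ⁻¹' {(j : ℕ)}) := measure_iUnion_le _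
    _ = ∑' j : J, P (ξ ⁻¹' B j) * P (N ⁻¹' {(j : ℕ)}) :=
        tsum_congr fun j => h.measure_inter_preimage_eq_mul _ _ (hB j) (measurableSet_singleton _)
    _ ≤ ∑' j : J, c * P (N ⁻¹' {(j : ℕ)}) := by
        gcongr with j
        exact hc j j.2
    _ = c * P (N ⁻¹' J) := by
        rw [ENNReal.tsum_mul_left, tsum_measure_preimage_singleton J.to_countable
          fun j _ => hN (measurableSet_singleton j)]
    _ ≤ c := mul_le_of_le_one_right' prob_le_one

variable {e : ℕ → Ω → ℝ} {σ : ℝ}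

/-- Chebyshev's inequality for sums of centred i.i.d. variables. -/
theorem measure_le_abs_sum_le (he_indep : iIndepFun e P)
    (he_ident : ∀ k, IdentDistrib (e k) (e 0) P P) (he_memLp : MemLp (e 0) 2 P)
    (he_mean : ∫ ω, e 0 ω ∂P = 0) (he_var : variance (e 0) P = σ ^ 2) (s : Finset ℕ) {c : ℝ}
    (hc : 0 < c) :
    P {ω | c ≤ |∑ i ∈ s, e i ω|} ≤ ENNReal.ofReal (s.card * σ ^ 2 / c ^ 2) := by
  have hL : ∀ i, MemLp (e i) 2 P := fun i => (he_ident i).memLp_iff.2 he_memLp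
  have hvar : variance (∑ i ∈ s, e i) P = s.card * σ ^ 2 := by
    rw [IndepFun.variance_sum (fun i _ => hL i) fun i _ j _ hij => he_indep.indepFun hij]
    simp [fun i => (he_ident i).variance_eq, he_var]
  have hmean : ∫ ω, (∑ i ∈ s, e i) ω ∂P = 0 := by
    simp only [Finset.sum_apply]
    rw [integral_finsetSum _ fun i _ => (hL i).integrable (by norm_num)]
    simp [fun i => (he_ident i).integral_eq, he_mean]
  have := meas_ge_le_variance_div_sq (memLp_finsetSum' s fun i _ => hL i) hc
  rw [hmean, hvar] at this
  simpa using this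

theorem measure_le_abs_sum_range_sub_le (he_indep : iIndepFun e P)
    (he_ident : ∀ k, IdentDistrib (e k) (e 0) P P) (he_memLp : MemLp (e 0) 2 P)
    (he_mean : ∫ ω, e 0 ω ∂P = 0) (he_var : variance (e 0) P = σ ^ 2) (j m : ℕ) {c : ℝ}
    (hc : 0 < c) :
    P {ω | c ≤ |∑ i ∈ Finset.range j, e i ω - ∑ i ∈ Finset.range m, e i ω|} ≤
      ENNReal.ofReal (|(j : ℝ) - m| * σ ^ 2 / c ^ 2) := by
  wlog hmj : m ≤ j generalizing j m
  · simpa only [abs_sub_comm] using this m j (le_of_not_ge hmj)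
  have := measure_le_abs_sum_le he_indep he_ident he_memLp he_mean he_var (Finset.Ico m j) hc
  simp only [Finset.sum_Ico_eq_sub _ hmj] at this
  rwa [Nat.card_Ico, Nat.cast_sub hmj, ← abs_of_nonneg (a := (j : ℝ) - m)
    (by simpa using hmj)] at this

/-- The sum up to a random index independent of the summands is close to the sum up to the
deterministic centre of the index. -/
theorem tendstoInMeasure_random_sum_sub (he_indep : iIndepFun e P)
    (he_ident : ∀ k, IdentDistrib (e k) (e 0) P P) (he_memLp : MemLp (e 0) 2 P)
    (he_mean : ∫ ω, e 0 ω ∂P = 0) (he_var : variance (e 0) P = σ ^ 2)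
    {N : ℕ → Ω → ℕ} (hN : ∀ n, Measurable (N n))
    (heN : ∀ n, IndepFun (fun ω (k : ℕ) => e k ω) (N n) P) {lam γ : ℝ} (hlam : 0 < lam)
    (hγ : 1 / 2 ≤ γ)
    (hN_lim : ∀ δ > 0, Tendsto (fun n : ℕ => P.real {ω | δ * n ≤ |(N n ω : ℝ) - lam * n|})
      atTop (𝓝 0)) :
    TendstoInMeasure P (fun (n : ℕ) ω => (n : ℝ) ^ (-γ) * (∑ k ∈ Finset.range (N n ω), e k ω -
      ∑ k ∈ Finset.range ⌊lam * n⌋₊, e k ω)) atTop (fun _ => 0) := by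
  rw [tendstoInMeasure_iff_measureReal_norm]
  intro ε hε
  have hlt : ∀ η > 0, ∀ᶠ n : ℕ in atTop, P.real {ω | ε ≤ ‖(n : ℝ) ^ (-γ) *
      (∑ k ∈ Finset.range (N n ω), e k ω - ∑ k ∈ Finset.range ⌊lam * n⌋₊, e k ω) - 0‖} < η := by
    intro η hη
    -- The left side is the Chebyshev bound obtained below; `σ ^ 2 + 1` keeps the denominator
    -- positive when `σ = 0`.
    obtain ⟨δ, hδ, hδη⟩ : ∃ δ > 0, 2 * δ * σ ^ 2 / ε ^ 2 ≤ η / 2 := by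
      refine ⟨η * ε ^ 2 / (4 * (σ ^ 2 + 1)), by positivity, ?_⟩
      rw [div_le_iff₀ (by positivity), mul_comm 2, mul_assoc, div_mul_eq_mul_div,
        div_le_iff₀ (by positivity)]
      nlinarith [show 0 < η * ε ^ 2 by positivity, sq_nonneg σ]
    have hinv : Tendsto (fun n : ℕ => (δ : ℝ) * n) atTop atTop :=
      (tendsto_natCast_atTop_atTop (R := ℝ)).const_mul_atTop hδ
    filter_upwards [(hN_lim δ hδ).eventually_lt_const (half_pos hη), eventually_gt_atTop 0,
      hinv.eventually_ge_atTop 1] with n hn hn0 hn1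
    have hn0' : (0 : ℝ) < n := by exact_mod_cast hn0
    have hgp : 0 < (n : ℝ) ^ γ := Real.rpow_pos_of_pos hn0' _
    set m := ⌊lam * n⌋₊ with hm
    set J : Set ℕ := {j | |(j : ℝ) - lam * n| < δ * n} with hJ
    set B : ℕ → Set (ℕ → ℝ) := fun j =>
      {u | ε * (n : ℝ) ^ γ ≤ |∑ i ∈ Finset.range j, u i - ∑ i ∈ Finset.range m, u i|} with hB
    have hBm : ∀ j, MeasurableSet (B j) := fun j =>
      measurableSet_le measurable_const (by fun_prop)
    have hbound : ∀ j ∈ J, P ((fun ω (k : ℕ) => e k ω) ⁻¹' B j) ≤ ENNReal.ofReal (η / 2) := by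
      intro j hj
      refine (measure_le_abs_sum_range_sub_le he_indep he_ident he_memLp he_mean he_var j m
        (show 0 < ε * (n : ℝ) ^ γ by positivity)).trans (ENNReal.ofReal_le_ofReal ?_)
      -- One `δ * n` comes from `j ∈ J`, the other absorbs the floor error, as `1 ≤ δ * n`.
      have hjm : |(j : ℝ) - m| ≤ 2 * δ * n := by
        have h1 := Nat.floor_le (show 0 ≤ lam * n by positivity)
        have h2 := Nat.lt_floor_add_one (lam * n)
        have h3 := abs_lt.1 (show |(j : ℝ) - lam * n| < δ * n from hj)
        rw [← hm] at h1 h2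
        rw [abs_le]
        constructor <;> linarith
      -- This is where `γ ≥ 1/2` enters: the variance, of order `n`, is at most of the order of the
      -- squared normalization.
      have hnγ : (n : ℝ) ≤ ((n : ℝ) ^ γ) ^ 2 := by
        rw [← Real.rpow_mul_natCast hn0'.le]
        nth_rw 1 [← Real.rpow_one (n : ℝ)]
        refine Real.rpow_le_rpow_of_exponent_le (by exact_mod_cast hn0) ?_
        push_cast
        linarith
      calc |(j : ℝ) - m| * σ ^ 2 / (ε * (n : ℝ) ^ γ) ^ 2
          ≤ (2 * δ * n) * σ ^ 2 / (ε ^ 2 * n) := by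
            rw [mul_pow]
            gcongr
        _ = 2 * δ * σ ^ 2 / ε ^ 2 := by field_simp
        _ ≤ η / 2 := hδη
    have hmain := measure_mem_and_mem_random_index_le (hN n) (heN n) hBm hbound
    have hmain' := ENNReal.toReal_mono ENNReal.ofReal_ne_top hmain
    rw [ENNReal.toReal_ofReal (half_pos hη).le] at hmain'
    -- Either the index is far from `λn`, or it lies in `J` and the shock increment is large.
    calc P.real {ω | ε ≤ ‖(n : ℝ) ^ (-γ) *
          (∑ k ∈ Finset.range (N n ω), e k ω - ∑ k ∈ Finset.range m, e k ω) - 0‖}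
        ≤ P.real ({ω | δ * n ≤ |(N n ω : ℝ) - lam * n|} ∪
            {ω | N n ω ∈ J ∧ (fun k => e k ω) ∈ B (N n ω)}) := by
          refine measureReal_mono fun ω hω => ?_
          rcases le_or_gt (δ * n) |(N n ω : ℝ) - lam * n| with h | h
          · exact .inl h
          · refine .inr ⟨h, ?_⟩
            have hω' : ε ≤ ‖(n : ℝ) ^ (-γ) * (∑ k ∈ Finset.range (N n ω), e k ω -
              ∑ k ∈ Finset.range m, e k ω) - 0‖ := hω
            rw [sub_zero, norm_mul, Real.norm_eq_abs, Real.norm_eq_abs,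
              abs_of_pos (Real.rpow_pos_of_pos hn0' _), Real.rpow_neg hn0'.le,
              ← div_eq_inv_mul, le_div_iff₀ hgp] at hω'
            exact hω'
      _ ≤ _ := measureReal_union_le _ _
      _ < η / 2 + η / 2 := add_lt_add_of_lt_of_le hn hmain'
      _ = η := add_halves η
  rw [Metric.tendsto_nhds]
  intro η hη
  filter_upwards [hlt η hη] with n hn
  rwa [Real.dist_eq, sub_zero, abs_of_nonneg measureReal_nonneg]

/-- Partial sums normalized faster than the central limit theorem vanish in probability. -/
theorem tendstoInMeasure_sum_floor (he_indep : iIndepFun e P)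
    (he_ident : ∀ k, IdentDistrib (e k) (e 0) P P) (he_memLp : MemLp (e 0) 2 P)
    (he_mean : ∫ ω, e 0 ω ∂P = 0) (he_var : variance (e 0) P = σ ^ 2) {lam γ : ℝ}
    (hlam : 0 < lam) (hγ : 1 / 2 < γ) :
    TendstoInMeasure P
      (fun (n : ℕ) ω => (n : ℝ) ^ (-γ) * ∑ k ∈ Finset.range ⌊lam * n⌋₊, e k ω)
      atTop (fun _ => 0) := by
  rw [tendstoInMeasure_iff_norm]
  intro ε hε
  have hlim : Tendsto (fun n : ℕ => ENNReal.ofReal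
      (lam * σ ^ 2 / ε ^ 2 * (n : ℝ) ^ (-(2 * γ - 1)))) atTop (𝓝 0) := by
    have := (tendsto_natCast_rpow_neg (show 0 < 2 * γ - 1 by linarith)).const_mul
      (lam * σ ^ 2 / ε ^ 2)
    rw [mul_zero] at this
    simpa using ENNReal.tendsto_ofReal this
  refine tendsto_of_tendsto_of_tendsto_of_le_of_le' tendsto_const_nhds hlim
    (.of_forall fun _ => zero_le) ?_
  filter_upwards [eventually_gt_atTop 0] with n hn0
  have hn0' : (0 : ℝ) < n := by exact_mod_cast hn0
  have hgp : 0 < (n : ℝ) ^ γ := Real.rpow_pos_of_pos hn0' _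
  refine le_trans (measure_mono fun ω hω => ?_)
    ((measure_le_abs_sum_le he_indep he_ident he_memLp he_mean he_var
      (Finset.range ⌊lam * n⌋₊) (show 0 < ε * (n : ℝ) ^ γ by positivity)).trans
      (ENNReal.ofReal_le_ofReal ?_))
  · have hω' : ε ≤ ‖(n : ℝ) ^ (-γ) * ∑ k ∈ Finset.range ⌊lam * n⌋₊, e k ω - 0‖ := hω
    rw [sub_zero, norm_mul, Real.norm_eq_abs, Real.norm_eq_abs,
      abs_of_pos (Real.rpow_pos_of_pos hn0' _), Real.rpow_neg hn0'.le,
      ← div_eq_inv_mul, le_div_iff₀ hgp] at hω'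
    exact hω'
  · have hpow : (n : ℝ) / ((n : ℝ) ^ γ) ^ 2 = (n : ℝ) ^ (-(2 * γ - 1)) := by
      rw [← Real.rpow_mul_natCast hn0'.le]
      nth_rw 1 [← Real.rpow_one (n : ℝ)]
      rw [← Real.rpow_sub hn0']
      push_cast
      ring_nf
    calc ((Finset.range ⌊lam * n⌋₊).card : ℝ) * σ ^ 2 / (ε * (n : ℝ) ^ γ) ^ 2
        ≤ (lam * n) * σ ^ 2 / (ε * (n : ℝ) ^ γ) ^ 2 := by
          rw [Finset.card_range]
          gcongr
          exact Nat.floor_le (by positivity)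
      _ = lam * σ ^ 2 / ε ^ 2 * ((n : ℝ) / ((n : ℝ) ^ γ) ^ 2) := by
          field_simp
      _ = _ := by rw [hpow]

/-- The central limit theorem along the indices `⌊lam * n⌋`. -/
theorem tendstoInDistribution_sum_floor (he_indep : iIndepFun e P)
    (he_ident : ∀ k, IdentDistrib (e k) (e 0) P P) (he_memLp : MemLp (e 0) 2 P)
    (he_mean : ∫ ω, e 0 ω ∂P = 0) (he_var : variance (e 0) P = σ ^ 2) {lam : ℝ}
    (hlam : 0 < lam) {Z : Ω' → ℝ} (hZ : HasLaw Z (gaussianReal 0 1) P') :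
    TendstoInDistribution
      (fun (n : ℕ) ω => (n : ℝ) ^ (-(1 / 2) : ℝ) * ∑ k ∈ Finset.range ⌊lam * n⌋₊, e k ω)
      atTop (fun ω => √lam * (σ * Z ω)) (fun _ => P) P' := by
  have hσZ : HasLaw (fun ω => σ * Z ω) (gaussianReal 0 (variance (e 0) P).toNNReal) P' := by
    convert gaussianReal_const_mul hZ σ using 2
    · simp
    · rw [he_var, mul_one]
      exact NNReal.eq (Real.coe_toNNReal _ (sq_nonneg σ))
  have hclt := tendstoInDistribution_inv_sqrt_mul_sum_sub hσZ he_memLp he_indep he_ident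
  have hdiv : Tendsto (fun n : ℕ => (⌊lam * n⌋₊ : ℝ) / n) atTop (𝓝 lam) :=
    (tendsto_nat_floor_mul_div_atTop hlam.le).comp tendsto_natCast_atTop_atTop
  have hfl : Tendsto (fun n : ℕ => ⌊lam * n⌋₊) atTop atTop := tendsto_atTop_of_tendsto_div hlam hdiv
  have h := (hclt.comp_tendsto hfl).const_mul_of_tendsto (hdiv.sqrt)
  refine h.congr (fun n => .of_forall fun ω => ?_) (.of_forall fun ω => rfl)
  simp only [he_mean, mul_zero, sub_zero]
  rw [Real.rpow_neg (Nat.cast_nonneg _), ← Real.sqrt_eq_rpow, Real.sqrt_div (Nat.cast_nonneg _),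
    ← mul_assoc]
  -- An empty sum makes both sides zero; otherwise `√⌊λn⌋` cancels.
  rcases Nat.eq_zero_or_pos ⌊lam * n⌋₊ with h0 | h0
  · simp [h0]
  · have : √(⌊lam * n⌋₊ : ℝ) ≠ 0 := (Real.sqrt_pos.2 (by exact_mod_cast h0)).ne'
    field_simp

end RandomSums

/-! ### The log price. -/

section LogPrice

variable {Ω Ω' : Type*} [MeasurableSpace Ω] {P : Measure Ω} [IsProbabilityMeasure P]
  [MeasurableSpace Ω'] {P' : Measure Ω'} [IsProbabilityMeasure P']

/-- A weak law of large numbers from a limit theorem with normalization `n ^ γ`, `γ < 1`. -/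
theorem tendsto_measureReal_abs_sub_ge {X : ℕ → Ω → ℝ} {Y : Ω' → ℝ} {lam γ : ℝ} (hγ1 : γ < 1)
    (h : TendstoInDistribution (fun (n : ℕ) ω => (n : ℝ) ^ (-γ) * (X n ω - lam * n))
      atTop Y (fun _ => P) P') {δ : ℝ} (hδ : 0 < δ) :
    Tendsto (fun n : ℕ => P.real {ω | δ * n ≤ |X n ω - lam * n|}) atTop (𝓝 0) := by
  -- The extra factor `n^(-(1-γ)) → 0` makes the limit identically zero, which lies outside the
  -- closed set `δ ≤ |x|` and so off its frontier.
  have h1 := h.const_mul_of_tendsto (tendsto_natCast_rpow_neg (show 0 < 1 - γ by linarith))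
  have h2 := h1.tendsto_measureReal_preimage (s := {x : ℝ | δ ≤ |x|})
    (measurableSet_le measurable_const (by fun_prop)) ?_
  · have h0 : (fun ω => 0 * Y ω) ⁻¹' {x : ℝ | δ ≤ |x|} = ∅ := by
      ext ω
      simp [hδ]
    rw [h0, measureReal_empty] at h2
    refine h2.congr' ?_
    filter_upwards [eventually_gt_atTop 0] with n hn0
    have hn0' : (0 : ℝ) < n := by exact_mod_cast hn0
    congr 1
    ext ω
    change δ ≤ |(n : ℝ) ^ (-(1 - γ)) * ((n : ℝ) ^ (-γ) * (X n ω - lam * n))| ↔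
      δ * n ≤ |X n ω - lam * n|
    rw [← mul_assoc, ← Real.rpow_add hn0', show -(1 - γ) + -γ = -1 by ring, Real.rpow_neg_one,
      abs_mul, abs_of_pos (inv_pos.2 hn0'), ← div_eq_inv_mul, le_div_iff₀ hn0']
  · have hsub : frontier {x : ℝ | δ ≤ |x|} ⊆ {x : ℝ | δ ≤ |x|} :=
      (isClosed_le continuous_const continuous_abs).frontier_subset
    refine measure_mono_null (Set.preimage_mono hsub) ?_
    convert measure_empty (μ := P')
    ext ω
    simp [hδ]

end LogPrice

theorem theorem1 {Ω : Type*} [MeasurableSpace Ω] (P : Measure Ω) [IsProbabilityMeasure P]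
    {Ω' : Type*} [MeasurableSpace Ω'] (P' : Measure Ω') [IsProbabilityMeasure P']
    -- the transaction times
    (T : ℤ → Ω → ℝ) (hT : IsPointProcess T)
    -- the shocks: i.i.d., mean zero, variance `σ ^ 2`, independent of the counting process
    (e : ℕ → Ω → ℝ) (σ : ℝ) (hσ : 0 ≤ σ)
    (he_indep : iIndepFun e P)
    (he_ident : ∀ k, IdentDistrib (e k) (e 0) P P)
    (he_memLp : MemLp (e 0) 2 P)
    (he_mean : ∫ ω, e 0 ω ∂P = 0)
    (he_var : variance (e 0) P = σ ^ 2)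
    (heN : IndepFun (fun ω (k : ℕ) => e k ω) (fun ω (t : ℝ≥0) => count T t ω) P)
    (μ lam γ : ℝ) (hlam : 0 < lam) (hγ : 1 / 2 ≤ γ) (hγ_lt : γ < 1)
    -- the normalized sums of durations converge in distribution to a nonzero `A`
    (A : Ω' → ℝ) (hA : ¬ A =ᵐ[P'] 0)
    (hconv : TendstoInDistribution
      (fun (n : ℕ) ω =>
        (n : ℝ) ^ (-γ) * ∑ k ∈ Finset.Icc (1 : ℤ) n, (duration T k ω - 1 / lam))
      atTop A (fun _ => P) P') :
    (1 / 2 < γ →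
      TendstoInDistribution
        (fun (n : ℕ) ω => (n : ℝ) ^ (-γ) * (logPrice μ T e n ω - lam * μ * n))
        atTop (fun ω' => -μ * lam ^ (1 + γ) * A ω') (fun _ => P) P') ∧
    (γ = 1 / 2 →
      ∀ {Ω'' : Type*} [MeasurableSpace Ω''] (P'' : Measure Ω'') [IsProbabilityMeasure P'']
        (A' Z : Ω'' → ℝ), IdentDistrib A' A P'' P' → HasLaw Z (gaussianReal 0 1) P'' →
        IndepFun A' Z P'' →
        TendstoInDistribution
          (fun (n : ℕ) ω =>
            (n : ℝ) ^ (-(1 / 2) : ℝ) * (logPrice μ T e n ω - lam * μ * n))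
          atTop (fun x => -μ * lam ^ (3 / 2 : ℝ) * A' x + √lam * σ * Z x)
          (fun _ => P) P'') := by
  have hγ0 : 0 < γ := by linarith
  have hcount := hT.tendstoInDistribution_count hlam hγ0 hγ_lt
    (hT.tendstoInDistribution_time hγ0 hconv)
  have heN' : ∀ n : ℕ, IndepFun (fun ω (k : ℕ) => e k ω) (count T n) P := fun n =>
    heN.comp measurable_id (measurable_pi_apply (n : ℝ≥0))
  have he : ∀ k, AEMeasurable (e k) P := fun k => (he_ident k).aemeasurable_fst
  have hsub := tendstoInMeasure_random_sum_sub he_indep he_ident he_memLp he_mean he_var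
    (fun n : ℕ => hT.measurable_count n) heN' hlam hγ
    (fun δ hδ => tendsto_measureReal_abs_sub_ge hγ_lt hcount hδ)
  have hsum : ∀ m, AEMeasurable (fun ω => ∑ k ∈ Finset.range m, e k ω) P := fun m =>
    Finset.aemeasurable_fun_sum _ fun k _ => he k
  have hsum_count : ∀ n : ℕ, AEMeasurable
      (fun ω => ∑ k ∈ Finset.range (count T n ω), e k ω) P := fun n => by
    -- The index is countable, so measurability for each fixed index gives joint measurability.
    have : Measurable fun p : ℕ × (ℕ → ℝ) => ∑ k ∈ Finset.range p.1, p.2 k :=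
      measurable_from_prod_countable_right fun m =>
        show Measurable fun u : ℕ → ℝ => ∑ k ∈ Finset.range m, u k by fun_prop
    exact this.comp_aemeasurable
      ((hT.measurable_count n).aemeasurable.prodMk (aemeasurable_pi_lambda _ he))
  have hsub_meas : ∀ n : ℕ, AEMeasurable (fun ω => (n : ℝ) ^ (-γ) *
      (∑ k ∈ Finset.range (count T n ω), e k ω - ∑ k ∈ Finset.range ⌊lam * n⌋₊, e k ω)) P :=
    fun n => ((hsum_count n).sub (hsum _)).const_mul _
  refine ⟨fun hγ' => ?_, ?_⟩
  · have h := ((hcount.continuous_comp (continuous_const_mul μ)).add_of_tendstoInMeasure_const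
      hsub hsub_meas).add_of_tendstoInMeasure_const
      (tendstoInMeasure_sum_floor he_indep he_ident he_memLp he_mean he_var hlam hγ')
      (fun n => (hsum _).const_mul _)
    refine h.congr (fun n => .of_forall fun ω => ?_) (.of_forall fun ω => ?_)
    · simp only [Pi.add_apply, Function.comp_apply, logPrice]
      ring
    · simp only [Function.comp_apply]
      ring
  · rintro rfl Ω'' _ P'' _ A' Z hA' hZ hAZ
    have hcount' : TendstoInDistribution
        (fun (n : ℕ) ω => (n : ℝ) ^ (-(1 / 2) : ℝ) * ((count T n ω : ℝ) - lam * n)) atTop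
        (fun x => -lam ^ (1 + 1 / 2 : ℝ) * A' x) (fun _ => P) P'' :=
      hcount.congr_limit (hA'.comp (measurable_const_mul (-lam ^ (1 + 1 / 2 : ℝ))))
    -- With `⌊λn⌋` in place of `N(n)`, the shock sum is a function of the shocks alone, hence
    -- independent of the count.
    have hclt := tendstoInDistribution_sum_floor he_indep he_ident he_memLp he_mean he_var hlam hZ
    have hpair := hcount'.prodMk_of_indepFun hclt
      (fun n => ((heN' n).comp
        (show Measurable fun u : ℕ → ℝ =>
          (n : ℝ) ^ (-(1 / 2) : ℝ) * ∑ k ∈ Finset.range ⌊lam * n⌋₊, u k by fun_prop)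
        (measurable_of_countable fun m : ℕ =>
          (n : ℝ) ^ (-(1 / 2) : ℝ) * ((m : ℝ) - lam * n))).symm)
      (hAZ.comp (measurable_const_mul (-lam ^ (1 + 1 / 2 : ℝ)))
        (show Measurable fun z : ℝ => √lam * (σ * z) by fun_prop))
    have h := (hpair.continuous_comp (g := fun p : ℝ × ℝ => μ * p.1 + p.2)
      (by fun_prop)).add_of_tendstoInMeasure_const hsub hsub_meas
    refine h.congr (fun n => .of_forall fun ω => ?_) (.of_forall fun ω => ?_)
    · simp only [Pi.add_apply, Function.comp_apply, logPrice]
      ring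
    · simp only [Function.comp_apply]
      rw [show (1 + 1 / 2 : ℝ) = 3 / 2 by norm_num]
      ring
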